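/- Let $d\ge 1$ and let $P,Q$ be probability distributions on $\mathbb{R}^d$ with the same one-dimensional marginals, i.e. for every $i$ the coordinate $x_i$ of $x=(x_1,\dots,x_d)$ has the same law under $P$ as under $Q$. Assume that under $P$, for all $i,j\in\{1,\dots,d\}$, the pair $(x_i,x_j)$ is a (possibly degenerate) two-dimensional Gaussian random vector, and that $\mathrm{Var}_P(x_i)>0$ for every $i$. (Under $Q$ the pairs are not required to be Gaussian.) Let $\tilde x_i=(x_i-\mathbb{E}_P[x_i])\,\mathrm{Var}_P(x_i)^{-1/2}$, let $\tilde\Sigma_P=\mathbb{E}_P[\tilde x\tilde x^\top]$ be the correlation matrix, and let $\lambda_{\min}(\tilde\Sigma_P)\ge 0$ be its smallest eigenvalue. Let $$\mathcal{F}=\Big\{x\mapsto \sum_{i=1}^d f_i(x_i)\;:\; f_i:\mathbb{R}\to\mathbb{R}\text{ measurable with respect to the completed law of }x_i,\ \mathbb{E}_P[f_i(x_i)^2]<\infty \text{ for all } i\Big\},$$ and define the $\mathcal{F}$-restricted error ratio $$\tau(P,Q,\mathcal{F})=\sup_{f,g\in\mathcal{F}}\frac{\mathbb{E}_Q[(f(x)-g(x))^2]}{\mathbb{E}_P[(f(x)-g(x))^2]}\in[0,\infty],$$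 with the conventions $0/0=0$ and $c/0=\infty$ for $c>0$. Then $$\tau(P,Q,\mathcal{F})\le \frac{d}{\lambda_{\min}(\tilde\Sigma_P)},$$ where the right-hand side is $+\infty$ if $\lambda_{\min}(\tilde\Sigma_P)=0$. -/

import Mathlib

open MeasureTheory ProbabilityTheory

noncomputable section

/-- The second moment `E_μ[h(x)²] ∈ [0, ∞]` of a real function `h`. -/
def secondMoment {X : Type*} [MeasurableSpace X] (μ : Measure X) (h : X → ℝ) : ENNReal :=
  ∫⁻ x, ENNReal.ofReal (h x ^ 2) ∂μ

/-- The `F`-restricted error ratio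
`τ(P, Q, F) = sup_{f, g ∈ F} E_Q[(f - g)²] / E_P[(f - g)²] ∈ [0, ∞]`.
Division in `ENNReal` has `0 / 0 = 0` and `c / 0 = ∞` for `c ≠ 0`. -/
def restrictedErrorRatio {X : Type*} [MeasurableSpace X] (P Q : Measure X)
    (F : Set (X → ℝ)) : ENNReal :=
  ⨆ f ∈ F, ⨆ g ∈ F,
    secondMoment Q (fun x => f x - g x) / secondMoment P (fun x => f x - g x)

/-- The class of additive models `x ↦ ∑ i, f_i (x_i)`, where the `f_i : ℝ → ℝ` are
(a.e.) measurable functions with `E_P[f_i(x_i)²] < ∞`. -/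
def additiveClass {d : ℕ} (P : Measure (Fin d → ℝ)) : Set ((Fin d → ℝ) → ℝ) :=
  {F | ∃ f : Fin d → ℝ → ℝ,
    (∀ i, AEMeasurable (f i) (P.map (fun x => x i))) ∧
    (∀ i, secondMoment P (fun x => f i (x i)) < ⊤) ∧
    F = fun x => ∑ i, f i (x i)}

/-- The `i`-th standardized feature `(x_i - E_P[x_i]) Var_P(x_i)^{-1/2}`. -/
def standardized {d : ℕ} (P : Measure (Fin d → ℝ)) (i : Fin d) (x : Fin d → ℝ) : ℝ :=
  (x i - ∫ y, y i ∂P) / Real.sqrt (variance (fun y => y i) P)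

/-- The second-moment matrix of the standardized features under `P`. -/
def correlationMatrix {d : ℕ} (P : Measure (Fin d → ℝ)) : Matrix (Fin d) (Fin d) ℝ :=
  Matrix.of fun i j => ∫ x, standardized P i x * standardized P j x ∂P

theorem correlationMatrix_isHermitian {d : ℕ} (P : Measure (Fin d → ℝ)) :
    (correlationMatrix P).IsHermitian := by
  ext i j
  simp [correlationMatrix, mul_comm]

/-- The smallest eigenvalue of a real symmetric matrix (of positive size). -/
def lambdaMin {d : ℕ} {M : Matrix (Fin d) (Fin d) ℝ} (hM : M.IsHermitian) : ℝ :=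
  ⨅ i, hM.eigenvalues i

end

/-!
For a Gaussian pair, `cov(e^{sX}, e^{tY})` is proportional to
`e^{st cov(X, Y)} - 1 = ∑_{m ≥ 1} cov(X, Y)^m (st)^m / m!`. Hence for linear combinations `f_i` of
exponentials, `Var_P(∑ f_i(x_i))` is a sum over `m ≥ 1` of quadratic forms in the Hadamard powers
`Σ^{∘m}` of the covariance matrix. If `Σ - λ diag Σ ≥ 0`, then by the Schur product theorem
`Σ^{∘m} - λ diag Σ^{∘m} = (Σ - λ diag Σ) ∘ Σ^{∘(m-1)} ≥ 0`, so
`λ ∑ Var_P(f_i(x_i)) ≤ Var_P(∑ f_i(x_i))`. Exponentials are total in `L²` of each marginal (an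
orthogonal `f` yields measures `f⁺ dμ` and `f⁻ dμ` with the same moment generating function), and
the inequality extends to all `f_i` by continuity. Conversely
`Var_Q(∑ f_i(x_i)) ≤ d ∑ Var_Q(f_i(x_i))` for every `Q`, and the variances on the right, as well
as the mean of the sum, depend only on the marginals. The means contribute `λ m² ≤ d m²`, because
`λ_min` of a correlation matrix is at most `1`.
-/

open scoped Matrix MatrixOrder ComplexOrder

section HadamardPower

variable {n 𝕜 : Type*} [Finite n] [RCLike 𝕜] {A : Matrix n n 𝕜}

theorem posSemidef_map_pow (hA : A.PosSemidef) (k : ℕ) : (A.map (· ^ k)).PosSemidef := by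
  induction k with
  | zero =>
    have h_ones : A.map (· ^ 0) = Matrix.vecMulVec 1 (star 1) := by
      ext i j
      simp [Matrix.vecMulVec_apply]
    exact h_ones ▸ Matrix.posSemidef_vecMulVec_self_star 1
  | succ k ih =>
    have h_mul : A.map (· ^ (k + 1)) = A.map (· ^ k) ⊙ A := by
      ext i j
      simp [pow_succ]
    exact h_mul ▸ ih.hadamard hA

theorem posSemidef_map_pow_sub_smul_diagonal [DecidableEq n] {c : 𝕜} (hA : A.PosSemidef)
    (hc : (A - c • Matrix.diagonal A.diag).PosSemidef) (k : ℕ) :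
    (A.map (· ^ (k + 1)) - c • Matrix.diagonal (A.map (· ^ (k + 1))).diag).PosSemidef := by
  have h_mul : A.map (· ^ (k + 1)) - c • Matrix.diagonal (A.map (· ^ (k + 1))).diag =
      (A - c • Matrix.diagonal A.diag) ⊙ A.map (· ^ k) := by
    ext i j
    obtain rfl | hij := eq_or_ne i j
    · simp [pow_succ']
      ring
    · simp [hij, pow_succ']
  exact h_mul ▸ hc.hadamard (posSemidef_map_pow hA k)

end HadamardPower

theorem mul_sum_diag_le_sum_sum_of_posSemidef {n : Type*} [Fintype n] [DecidableEq n]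
    {A : Matrix n n ℝ} {c : ℝ} (hc : (A - c • Matrix.diagonal A.diag).PosSemidef) (b : n → ℝ) :
    c * ∑ i, A i i * (b i * b i) ≤ ∑ i, ∑ j, A i j * (b i * b j) := by
  have h := hc.dotProduct_mulVec_nonneg b
  simp only [star_trivial, Matrix.sub_mulVec, Matrix.smul_mulVec, dotProduct_sub,
    dotProduct_smul, smul_eq_mul, sub_nonneg] at h
  have h_diag : b ⬝ᵥ Matrix.diagonal A.diag *ᵥ b = ∑ i, A i i * (b i * b i) := by
    simp only [dotProduct, Matrix.mulVec_diagonal, Matrix.diag_apply]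
    exact Finset.sum_congr rfl fun i _ => by ring
  have h_full : b ⬝ᵥ A *ᵥ b = ∑ i, ∑ j, A i j * (b i * b j) := by
    simp only [dotProduct, Matrix.mulVec, Finset.mul_sum]
    exact Finset.sum_congr rfl fun i _ => Finset.sum_congr rfl fun j _ => by ring
  rwa [h_diag, h_full] at h

theorem measure_eq_of_mgf_id_eq {μ ν : Measure ℝ} [IsFiniteMeasure μ] [IsFiniteMeasure ν]
    (hμ : integrableExpSet id μ = Set.univ) (h : mgf id μ = mgf id ν) : μ = ν := by
  have h_mass : μ.real Set.univ = ν.real Set.univ := by simpa using congrFun h 0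
  have h_zero : μ = 0 ↔ ν = 0 := by
    rw [← Measure.measure_univ_eq_zero, ← Measure.measure_univ_eq_zero,
      ← measureReal_eq_zero_iff, ← measureReal_eq_zero_iff, h_mass]
  refine Measure.ext_of_complexMGF_id_eq (funext fun z => ?_)
  exact eqOn_complexMGF_of_mgf' h h_zero (by simp [hμ])

section ExponentialsTotal

variable {μ : Measure ℝ}

theorem mgf_id_withDensity_ofReal {f : ℝ → ℝ} (hf : AEMeasurable f μ) (t : ℝ) :
    mgf id (μ.withDensity fun x => ENNReal.ofReal (f x)) t =
      ∫ x, max (f x) 0 * Real.exp (t * x) ∂μ := by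
  rw [mgf, integral_withDensity_eq_integral_toReal_smul₀ hf.ennreal_ofReal (by simp)]
  simp [ENNReal.toReal_ofReal']

theorem integrableExpSet_id_withDensity_ofReal {f : ℝ → ℝ}
    (hf : ∀ t, Integrable (fun x => f x * Real.exp (t * x)) μ) :
    integrableExpSet id (μ.withDensity fun x => ENNReal.ofReal (f x)) = Set.univ := by
  have hfm : AEMeasurable f μ := by simpa using (hf 0).aemeasurable
  refine Set.eq_univ_of_forall fun t => ?_
  change Integrable _ _
  rw [integrable_withDensity_iff_integrable_smul₀' hfm.ennreal_ofReal (by simp)]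
  refine (hf t).pos_part.congr (.of_forall fun x => ?_)
  simp [ENNReal.toReal_ofReal', max_mul_of_nonneg _ _ (Real.exp_pos (t * x)).le]

theorem ae_eq_zero_of_forall_integral_mul_exp_eq_zero {f : ℝ → ℝ}
    (hf : ∀ t, Integrable (fun x => f x * Real.exp (t * x)) μ)
    (h : ∀ t, ∫ x, f x * Real.exp (t * x) ∂μ = 0) : f =ᵐ[μ] 0 := by
  have hf_neg : ∀ t, Integrable (fun x => -f x * Real.exp (t * x)) μ := fun t => by
    simpa using (hf t).neg
  have hfi : Integrable f μ := by simpa using hf 0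
  have hfi_neg : Integrable (fun x => -f x) μ := hfi.neg
  have := isFiniteMeasure_withDensity_ofReal hfi.2
  have := isFiniteMeasure_withDensity_ofReal hfi_neg.2
  have h_mgf : mgf id (μ.withDensity fun x => ENNReal.ofReal (f x)) =
      mgf id (μ.withDensity fun x => ENNReal.ofReal (-f x)) := by
    ext t
    rw [mgf_id_withDensity_ofReal hfi.aemeasurable, mgf_id_withDensity_ofReal hfi_neg.aemeasurable,
      ← sub_eq_zero, ← integral_sub]
    · simp only [← sub_mul, max_zero_sub_max_neg_zero_eq_self, h t]
    · simpa [max_mul_of_nonneg _ _ (Real.exp_pos _).le] using (hf t).pos_part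
    · simpa [max_mul_of_nonneg _ _ (Real.exp_pos _).le] using (hf_neg t).pos_part
  have h_density := (withDensity_eq_iff hfi.aemeasurable.ennreal_ofReal
    hfi_neg.aemeasurable.ennreal_ofReal hfi.lintegral_lt_top.ne).1
      (measure_eq_of_mgf_id_eq (integrableExpSet_id_withDensity_ofReal hf) h_mgf)
  filter_upwards [h_density] with x hx
  have h_toReal := congrArg ENNReal.toReal hx
  simp only [ENNReal.toReal_ofReal'] at h_toReal
  rw [Pi.zero_apply, ← max_zero_sub_max_neg_zero_eq_self (f x), h_toReal, sub_self]

theorem topologicalClosure_span_exp_eq_top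
    (hexp : ∀ t : ℝ, MemLp (fun x => Real.exp (t * x)) 2 μ) :
    (Submodule.span ℝ (Set.range fun t => (hexp t).toLp)).topologicalClosure = ⊤ := by
  rw [Submodule.topologicalClosure_eq_top_iff, Submodule.eq_bot_iff]
  intro f hf
  rw [Lp.eq_zero_iff_ae_eq_zero]
  refine ae_eq_zero_of_forall_integral_mul_exp_eq_zero
    (fun t => (Lp.memLp f).integrable_mul (hexp t)) fun t => ?_
  have h_orth := (Submodule.mem_orthogonal _ _).1 hf _ (Submodule.subset_span ⟨t, rfl⟩)
  rw [← h_orth, L2.inner_def]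
  refine integral_congr_ae ?_
  filter_upwards [(hexp t).coeFn_toLp] with x hx
  simp [hx]

end ExponentialsTotal

section GaussianExponential

variable {Ω : Type*} [MeasurableSpace Ω] {P : Measure Ω} {X Y : Ω → ℝ}

theorem mgf_eq_exp_of_hasGaussianLaw (hX : HasGaussianLaw X P) (t : ℝ) :
    mgf X P t = Real.exp (P[X] * t + Var[X; P] * t ^ 2 / 2) := by
  rw [mgf_gaussianReal hX.map_eq_gaussianReal, Real.coe_toNNReal _ (variance_nonneg X P)]

theorem memLp_exp_mul_of_hasGaussianLaw (hX : HasGaussianLaw X P) (t : ℝ) :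
    MemLp (fun ω => Real.exp (t * X ω)) 2 P := by
  have := hX.isProbabilityMeasure
  have hm : AEStronglyMeasurable (fun ω => Real.exp (t * X ω)) P :=
    (Real.continuous_exp.comp (continuous_const_mul t)).comp_aestronglyMeasurable
      hX.aemeasurable.aestronglyMeasurable
  rw [memLp_two_iff_integrable_sq hm]
  have h_int : Integrable (fun ω => Real.exp (2 * t * X ω)) P := by
    rw [← mgf_pos_iff, mgf_eq_exp_of_hasGaussianLaw hX]
    positivity
  refine h_int.congr (.of_forall fun ω => ?_)
  simp only [← Real.exp_nat_mul]
  ring_nf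

theorem covariance_exp_mul_exp_mul_of_hasGaussianLaw
    (hXY : HasGaussianLaw (fun ω => (X ω, Y ω)) P) (s t : ℝ) :
    cov[fun ω => Real.exp (s * X ω), fun ω => Real.exp (t * Y ω); P] =
      mgf X P s * mgf Y P t * (Real.exp (cov[X, Y; P] * (s * t)) - 1) := by
  have := hXY.isProbabilityMeasure
  have hX : HasGaussianLaw X P := hXY.fst
  have hY : HasGaussianLaw Y P := hXY.snd
  have hZ : HasGaussianLaw (fun ω => s * X ω + t * Y ω) P :=
    hXY.map_fun (s • ContinuousLinearMap.fst ℝ ℝ ℝ + t • ContinuousLinearMap.snd ℝ ℝ ℝ)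
  have hsX : MemLp (fun ω => s * X ω) 2 P := hX.memLp_two.const_mul s
  have htY : MemLp (fun ω => t * Y ω) 2 P := hY.memLp_two.const_mul t
  have h_mean : P[fun ω => s * X ω + t * Y ω] = s * P[X] + t * P[Y] := by
    rw [integral_add (hsX.integrable one_le_two) (htY.integrable one_le_two),
      integral_const_mul, integral_const_mul]
  have h_var : Var[fun ω => s * X ω + t * Y ω; P] =
      s ^ 2 * Var[X; P] + 2 * (s * (t * cov[X, Y; P])) + t ^ 2 * Var[Y; P] := by
    rw [variance_fun_add hsX htY, variance_const_mul, variance_const_mul,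
      covariance_const_mul_left, covariance_const_mul_right]
  have h_joint : P[fun ω => Real.exp (s * X ω) * Real.exp (t * Y ω)] =
      mgf X P s * mgf Y P t * Real.exp (cov[X, Y; P] * (s * t)) := by
    have h_mgf := mgf_eq_exp_of_hasGaussianLaw hZ 1
    simp only [mgf, one_mul, Real.exp_add, h_mean, h_var] at h_mgf
    rw [h_mgf, mgf_eq_exp_of_hasGaussianLaw hX, mgf_eq_exp_of_hasGaussianLaw hY]
    simp only [← Real.exp_add]
    ring_nf
  rw [covariance_eq_sub (memLp_exp_mul_of_hasGaussianLaw hX s)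
    (memLp_exp_mul_of_hasGaussianLaw hY t), mul_sub_one, ← h_joint]
  rfl

end GaussianExponential

theorem hasSum_exp_sub_one (x : ℝ) :
    HasSum (fun m : ℕ => x ^ (m + 1) / (m + 1).factorial) (Real.exp x - 1) := by
  have h := NormedSpace.expSeries_div_hasSum_exp x
  rw [← Real.exp_eq_exp_ℝ] at h
  simpa using (hasSum_nat_add_iff' 1).2 h

/-- The exponential polynomial `∑ t, a t * exp (t * x)` with frequencies in the support of `a`. -/
noncomputable def expPolynomial (a : ℝ →₀ ℝ) (x : ℝ) : ℝ :=
  a.sum fun t c => c * Real.exp (t * x)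

theorem continuous_expPolynomial (a : ℝ →₀ ℝ) : Continuous (expPolynomial a) := by
  unfold expPolynomial Finsupp.sum
  fun_prop

section ExpPolynomial

variable {Ω : Type*} [MeasurableSpace Ω] {P : Measure Ω}

/-- The mean `E[f⁽ᵐ⁾(X)]` of the `m`-th derivative of `f = expPolynomial a`, written out in terms
of the moment generating function of `X`. These are the coefficients of `f` in the expansion of
Gaussian covariances. -/
noncomputable def meanIteratedDerivExpPolynomial (X : Ω → ℝ) (P : Measure Ω) (a : ℝ →₀ ℝ)
    (m : ℕ) : ℝ :=
  a.sum fun t c => c * (t ^ m * mgf X P t)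

theorem memLp_expPolynomial_comp {X : Ω → ℝ} (hX : HasGaussianLaw X P) (a : ℝ →₀ ℝ) :
    MemLp (fun ω => expPolynomial a (X ω)) 2 P :=
  memLp_finsetSum _ fun t _ => (memLp_exp_mul_of_hasGaussianLaw hX t).const_mul (a t)

theorem hasSum_covariance_expPolynomial {X Y : Ω → ℝ}
    (hXY : HasGaussianLaw (fun ω => (X ω, Y ω)) P) (a b : ℝ →₀ ℝ) :
    HasSum (fun m : ℕ => cov[X, Y; P] ^ (m + 1) / (m + 1).factorial *
        (meanIteratedDerivExpPolynomial X P a (m + 1) *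
          meanIteratedDerivExpPolynomial Y P b (m + 1)))
      cov[fun ω => expPolynomial a (X ω), fun ω => expPolynomial b (Y ω); P] := by
  have := hXY.isProbabilityMeasure
  have h_cov : cov[fun ω => expPolynomial a (X ω), fun ω => expPolynomial b (Y ω); P] =
      ∑ s ∈ a.support, ∑ t ∈ b.support, a s * b t *
        (mgf X P s * mgf Y P t * (Real.exp (cov[X, Y; P] * (s * t)) - 1)) := by
    simp only [expPolynomial, Finsupp.sum]
    rw [covariance_fun_sum_fun_sum'
      (fun s _ => (memLp_exp_mul_of_hasGaussianLaw hXY.fst s).const_mul (a s))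
      (fun t _ => (memLp_exp_mul_of_hasGaussianLaw hXY.snd t).const_mul (b t))]
    simp only [covariance_const_mul_left, covariance_const_mul_right,
      covariance_exp_mul_exp_mul_of_hasGaussianLaw hXY, mul_assoc,
      mul_left_comm (b _)]
  have h_sum := hasSum_sum fun s (_ : s ∈ a.support) => hasSum_sum fun t (_ : t ∈ b.support) =>
    ((hasSum_exp_sub_one (cov[X, Y; P] * (s * t))).mul_left (mgf X P s * mgf Y P t)).mul_left
      (a s * b t)
  rw [h_cov]
  refine h_sum.congr_fun fun m => ?_
  simp only [meanIteratedDerivExpPolynomial, Finsupp.sum]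
  rw [Finset.sum_mul_sum]
  simp only [Finset.mul_sum]
  exact Finset.sum_congr rfl fun s _ => Finset.sum_congr rfl fun t _ => by ring

end ExpPolynomial

/-- The matrix of covariances `cov[X i, X j; P]` of a family of real random variables. -/
noncomputable def covarianceMatrix {n Ω : Type*} [MeasurableSpace Ω] (X : n → Ω → ℝ)
    (P : Measure Ω) : Matrix n n ℝ :=
  Matrix.of fun i j => cov[X i, X j; P]

section CovarianceMatrix

variable {n Ω : Type*} [MeasurableSpace Ω] {X : n → Ω → ℝ} {P : Measure Ω}

theorem posSemidef_covarianceMatrix [Finite n] [IsFiniteMeasure P] (hX : ∀ i, MemLp (X i) 2 P) :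
    (covarianceMatrix X P).PosSemidef := by
  have := Fintype.ofFinite n
  refine .of_dotProduct_mulVec_nonneg (by ext i j; simp [covarianceMatrix, covariance_comm]) ?_
  intro b
  have h_var : Var[fun ω => ∑ i, b i * X i ω; P] = star b ⬝ᵥ covarianceMatrix X P *ᵥ b := by
    rw [variance_fun_sum fun i => (hX i).const_mul (b i)]
    simp only [covariance_const_mul_left, covariance_const_mul_right, covarianceMatrix,
      dotProduct, Matrix.mulVec, Matrix.of_apply, Finset.mul_sum, star_trivial]
    exact Finset.sum_congr rfl fun i _ => Finset.sum_congr rfl fun j _ => by ring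
  exact h_var ▸ variance_nonneg _ _

theorem mul_sum_variance_expPolynomial_le [Fintype n] [DecidableEq n] [IsFiniteMeasure P]
    {c : ℝ}
    (hX : ∀ i j, HasGaussianLaw (fun ω => (X i ω, X j ω)) P)
    (hc : (covarianceMatrix X P - c • Matrix.diagonal (covarianceMatrix X P).diag).PosSemidef)
    (a : n → ℝ →₀ ℝ) :
    c * ∑ i, Var[fun ω => expPolynomial (a i) (X i ω); P] ≤
      Var[fun ω => ∑ i, expPolynomial (a i) (X i ω); P] := by
  have hXi : ∀ i, HasGaussianLaw (X i) P := fun i => (hX i i).fst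
  set S := covarianceMatrix X P
  set D : ℕ → n → ℝ := fun m i => meanIteratedDerivExpPolynomial (X i) P (a i) m
  have h_cov : ∀ i j, HasSum
      (fun m : ℕ => ((m + 1).factorial : ℝ)⁻¹ * (S i j ^ (m + 1) * (D (m + 1) i * D (m + 1) j)))
      cov[fun ω => expPolynomial (a i) (X i ω), fun ω => expPolynomial (a j) (X j ω); P] :=
    fun i j => (hasSum_covariance_expPolynomial (hX i j) (a i) (a j)).congr_fun fun m => by
      simp only [S, D, covarianceMatrix, Matrix.of_apply]
      ring
  have h_diag := (hasSum_sum fun i (_ : i ∈ Finset.univ) => h_cov i i).mul_left c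
  have h_full := hasSum_sum fun i (_ : i ∈ Finset.univ) =>
    hasSum_sum fun j (_ : j ∈ Finset.univ) => h_cov i j
  rw [variance_fun_sum fun i => memLp_expPolynomial_comp (hXi i) (a i)]
  simp only [← covariance_self (memLp_expPolynomial_comp (hXi _) _).aemeasurable]
  refine hasSum_le (fun m => ?_) h_diag h_full
  have h_term := mul_sum_diag_le_sum_sum_of_posSemidef (posSemidef_map_pow_sub_smul_diagonal
    (posSemidef_covarianceMatrix fun i => (hXi i).memLp_two) hc m) (D (m + 1))
  simp only [← Finset.mul_sum, mul_left_comm c]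
  exact mul_le_mul_of_nonneg_left h_term (by positivity)

end CovarianceMatrix

theorem dense_expPolynomial_Lp {μ : Measure ℝ}
    (hexp : ∀ t : ℝ, MemLp (fun x => Real.exp (t * x)) 2 μ) :
    Dense {f : Lp ℝ 2 μ | ∃ a, f =ᵐ[μ] expPolynomial a} := by
  have h_span := Submodule.dense_iff_topologicalClosure_eq_top.2
    (topologicalClosure_span_exp_eq_top hexp)
  refine h_span.mono fun f hf => ?_
  obtain ⟨a, rfl⟩ := Finsupp.mem_span_range_iff_exists_finsupp.1 hf
  refine ⟨a, ?_⟩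
  have h_smul : ∀ᵐ x ∂μ, ∀ t ∈ a.support,
      (a t • (hexp t).toLp : Lp ℝ 2 μ) x = a t * Real.exp (t * x) :=
    (ae_ball_iff a.support.countable_toSet).2 fun t _ => by
      filter_upwards [Lp.coeFn_smul (a t) (hexp t).toLp, (hexp t).coeFn_toLp] with x h_smul h_exp
      rw [h_smul, Pi.smul_apply, h_exp, smul_eq_mul]
  filter_upwards [Lp.coeFn_fun_finsetSum a.support fun t => a t • (hexp t).toLp, h_smul]
    with x h_sum h_smul
  rw [Finsupp.sum, h_sum]
  exact Finset.sum_congr rfl h_smul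

section AdditiveVariance

variable {n Ω : Type*} [Fintype n] [MeasurableSpace Ω] {P : Measure Ω} {μ : n → Measure ℝ}
  {X : n → Ω → ℝ}

theorem sum_comp_ae_eq (hX : ∀ i, MeasurePreserving (X i) P (μ i)) {f g : n → ℝ → ℝ}
    (hfg : ∀ i, f i =ᵐ[μ i] g i) :
    (fun ω => ∑ i, f i (X i ω)) =ᵐ[P] fun ω => ∑ i, g i (X i ω) := by
  filter_upwards [eventually_countable_forall.2 fun i =>
    (hX i).quasiMeasurePreserving.ae_eq_comp (hfg i)] with ω hω
  exact Finset.sum_congr rfl fun i _ => hω i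

theorem continuous_variance_Lp [IsProbabilityMeasure P] :
    Continuous fun f : Lp ℝ 2 P => Var[f; P] := by
  have h_var : ∀ f : Lp ℝ 2 P, Var[f; P] = inner ℝ f f -
      inner ℝ (indicatorConstLp 2 .univ (measure_ne_top P _) 1) f ^ 2 := fun f => by
    rw [variance_eq_sub (Lp.memLp f), L2.inner_indicatorConstLp_one, setIntegral_univ,
      L2.inner_def]
    simp [sq]
  simp only [h_var]
  fun_prop

theorem continuous_variance_sum_comp_Lp [IsProbabilityMeasure P]
    (hX : ∀ i, MeasurePreserving (X i) P (μ i)) :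
    Continuous fun w : (i : n) → Lp ℝ 2 (μ i) => Var[fun ω => ∑ i, w i (X i ω); P] := by
  have h_var : ∀ w : (i : n) → Lp ℝ 2 (μ i), Var[fun ω => ∑ i, w i (X i ω); P] =
      Var[(∑ i, Lp.compMeasurePreservingₗᵢ ℝ (X i) (hX i) (w i) : Lp ℝ 2 P); P] := fun w => by
    refine variance_congr ?_
    filter_upwards [Lp.coeFn_fun_finsetSum Finset.univ fun i =>
        Lp.compMeasurePreservingₗᵢ ℝ (X i) (hX i) (w i),
      eventually_countable_forall.2 fun i => Lp.coeFn_compMeasurePreserving (w i) (hX i)]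
      with ω h_sum h_comp
    rw [h_sum]
    exact Finset.sum_congr rfl fun i _ => (h_comp i).symm
  simp only [h_var]
  exact continuous_variance_Lp.comp (by fun_prop)

theorem mul_sum_variance_le_variance_sum_comp [DecidableEq n] [IsProbabilityMeasure P] {c : ℝ}
    (hX : ∀ i, MeasurePreserving (X i) P (μ i))
    (h_gauss : ∀ i j, HasGaussianLaw (fun ω => (X i ω, X j ω)) P)
    (hc : (covarianceMatrix X P - c • Matrix.diagonal (covarianceMatrix X P).diag).PosSemidef)
    {g : n → ℝ → ℝ} (hg : ∀ i, MemLp (g i) 2 (μ i)) :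
    c * ∑ i, Var[g i; μ i] ≤ Var[fun ω => ∑ i, g i (X i ω); P] := by
  have h_prob : ∀ i, IsProbabilityMeasure (μ i) := fun i =>
    (hX i).map_eq ▸ Measure.isProbabilityMeasure_map (hX i).aemeasurable
  have hexp : ∀ i t, MemLp (fun x => Real.exp (t * x)) 2 (μ i) := fun i t => by
    rw [← (hX i).map_eq, memLp_map_measure_iff (by fun_prop) (hX i).aemeasurable]
    exact memLp_exp_mul_of_hasGaussianLaw (h_gauss i i).fst t
  let good : Set ((i : n) → Lp ℝ 2 (μ i)) :=
    {w | c * ∑ i, Var[w i; μ i] ≤ Var[fun ω => ∑ i, w i (X i ω); P]}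
  have h_closed : IsClosed good := by
    refine isClosed_le (continuous_const.mul (continuous_finsetSum _ fun i _ => ?_))
      (continuous_variance_sum_comp_Lp hX)
    exact continuous_variance_Lp.comp (continuous_apply i)
  have h_exp : Set.univ.pi (fun i => {f : Lp ℝ 2 (μ i) | ∃ a, f =ᵐ[μ i] expPolynomial a}) ⊆
      good := fun w hw => by
    choose a ha using fun i => hw i (Set.mem_univ i)
    have h_le := mul_sum_variance_expPolynomial_le h_gauss hc a
    have h_law : ∀ i, Var[fun ω => expPolynomial (a i) (X i ω); P] = Var[w i; μ i] := fun i => by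
      rw [(hX i).variance_fun_comp (continuous_expPolynomial (a i)).aemeasurable,
        variance_congr (ha i)]
    simpa only [good, Set.mem_ofPred_eq, h_law, variance_congr (sum_comp_ae_eq hX ha)] using h_le
  have h_mem := h_closed.closure_subset_iff.2 h_exp
    (dense_pi Set.univ (fun i _ => dense_expPolynomial_Lp (hexp i)) fun i => (hg i).toLp)
  simpa only [good, Set.mem_ofPred_eq, variance_congr (hg _).coeFn_toLp,
    variance_congr (sum_comp_ae_eq hX fun i => (hg i).coeFn_toLp)] using h_mem

theorem variance_sum_le_card_mul_sum_variance [IsFiniteMeasure P] (hX : ∀ i, MemLp (X i) 2 P) :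
    Var[fun ω => ∑ i, X i ω; P] ≤ Fintype.card n * ∑ i, Var[X i; P] := by
  have h_cov : ∀ i j, cov[X i, X j; P] ≤ (Var[X i; P] + Var[X j; P]) / 2 := fun i j => by
    have h_nonneg := variance_nonneg (X i - X j) P
    rw [variance_sub (hX i) (hX j)] at h_nonneg
    linarith
  calc Var[fun ω => ∑ i, X i ω; P]
      = ∑ i, ∑ j, cov[X i, X j; P] := variance_fun_sum hX
    _ ≤ ∑ i, ∑ j, (Var[X i; P] + Var[X j; P]) / 2 := by gcongr; exact h_cov _ _
    _ = Fintype.card n * ∑ i, Var[X i; P] := by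
      simp only [← Finset.sum_div, Finset.sum_add_distrib, Finset.sum_const, Finset.card_univ,
        nsmul_eq_mul, ← Finset.mul_sum]
      ring

theorem mul_variance_sum_comp_le_card_mul_variance_sum_comp [DecidableEq n]
    [IsProbabilityMeasure P] {Ω' : Type*} [MeasurableSpace Ω'] {Q : Measure Ω'}
    [IsFiniteMeasure Q] {Y : n → Ω' → ℝ} {c : ℝ} (hX : ∀ i, MeasurePreserving (X i) P (μ i))
    (hY : ∀ i, MeasurePreserving (Y i) Q (μ i))
    (h_gauss : ∀ i j, HasGaussianLaw (fun ω => (X i ω, X j ω)) P)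
    (hc : (covarianceMatrix X P - c • Matrix.diagonal (covarianceMatrix X P).diag).PosSemidef)
    (hc₀ : 0 ≤ c) {g : n → ℝ → ℝ} (hg : ∀ i, MemLp (g i) 2 (μ i)) :
    c * Var[fun ω => ∑ i, g i (Y i ω); Q] ≤
      Fintype.card n * Var[fun ω => ∑ i, g i (X i ω); P] := by
  have h_law : ∀ i, Var[fun ω => g i (Y i ω); Q] = Var[g i; μ i] := fun i =>
    (hY i).variance_fun_comp (hg i).aemeasurable
  have h_sum : Var[fun ω => ∑ i, g i (Y i ω); Q] ≤ Fintype.card n * ∑ i, Var[g i; μ i] := by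
    simp only [← h_law]
    exact variance_sum_le_card_mul_sum_variance fun i => (hg i).comp_measurePreserving (hY i)
  calc c * Var[fun ω => ∑ i, g i (Y i ω); Q]
      ≤ c * (Fintype.card n * ∑ i, Var[g i; μ i]) := by gcongr
    _ = Fintype.card n * (c * ∑ i, Var[g i; μ i]) := by ring
    _ ≤ Fintype.card n * Var[fun ω => ∑ i, g i (X i ω); P] := by
      gcongr
      exact mul_sum_variance_le_variance_sum_comp hX h_gauss hc hg

theorem memLp_sum_comp (hX : ∀ i, MeasurePreserving (X i) P (μ i)) {g : n → ℝ → ℝ}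
    (hg : ∀ i, MemLp (g i) 2 (μ i)) : MemLp (fun ω => ∑ i, g i (X i ω)) 2 P :=
  memLp_finsetSum _ fun i _ => (hg i).comp_measurePreserving (hX i)

theorem integral_sum_comp (hX : ∀ i, MeasurePreserving (X i) P (μ i)) {g : n → ℝ → ℝ}
    (hg : ∀ i, Integrable (g i) (μ i)) :
    ∫ ω, ∑ i, g i (X i ω) ∂P = ∑ i, ∫ x, g i x ∂μ i := by
  have h_int : ∀ i, Integrable (fun ω => g i (X i ω)) P := fun i =>
    (hX i).integrable_comp_of_integrable (hg i)
  rw [integral_finsetSum _ fun i _ => h_int i]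
  refine Finset.sum_congr rfl fun i _ => ?_
  rw [← (hX i).map_eq, integral_map (hX i).aemeasurable ((hX i).map_eq ▸ (hg i).1)]

theorem mul_integral_sq_sum_comp_le_card_mul_integral_sq_sum_comp [DecidableEq n]
    [IsProbabilityMeasure P] {Ω' : Type*} [MeasurableSpace Ω'] {Q : Measure Ω'}
    [IsProbabilityMeasure Q] {Y : n → Ω' → ℝ} {c : ℝ} (hX : ∀ i, MeasurePreserving (X i) P (μ i))
    (hY : ∀ i, MeasurePreserving (Y i) Q (μ i))
    (h_gauss : ∀ i j, HasGaussianLaw (fun ω => (X i ω, X j ω)) P)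
    (hc : (covarianceMatrix X P - c • Matrix.diagonal (covarianceMatrix X P).diag).PosSemidef)
    (hc₀ : 0 ≤ c) (hcn : c ≤ Fintype.card n) {g : n → ℝ → ℝ} (hg : ∀ i, MemLp (g i) 2 (μ i)) :
    c * ∫ ω, (∑ i, g i (Y i ω)) ^ 2 ∂Q ≤ Fintype.card n * ∫ ω, (∑ i, g i (X i ω)) ^ 2 ∂P := by
  have h_prob : ∀ i, IsProbabilityMeasure (μ i) := fun i =>
    (hX i).map_eq ▸ Measure.isProbabilityMeasure_map (hX i).aemeasurable
  have hg_int : ∀ i, Integrable (g i) (μ i) := fun i => (hg i).integrable one_le_two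
  have hP := variance_eq_sub (memLp_sum_comp hX hg)
  have hQ := variance_eq_sub (memLp_sum_comp hY hg)
  rw [integral_sum_comp hX hg_int] at hP
  rw [integral_sum_comp hY hg_int] at hQ
  have h_var := mul_variance_sum_comp_le_card_mul_variance_sum_comp hX hY h_gauss hc hc₀ hg
  have h_mean := mul_le_mul_of_nonneg_right hcn (sq_nonneg (∑ i, ∫ x, g i x ∂μ i))
  rw [hP, hQ] at h_var
  simp only [Pi.pow_apply] at h_var
  linarith

end AdditiveVariance

section CorrelationMatrix

variable {d : ℕ} {P : Measure (Fin d → ℝ)}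

theorem posSemidef_sub_lambdaMin {M : Matrix (Fin d) (Fin d) ℝ} (hM : M.IsHermitian) :
    (M - lambdaMin hM • (1 : Matrix (Fin d) (Fin d) ℝ)).PosSemidef := by
  rw [← Matrix.le_iff, ← Algebra.algebraMap_eq_smul_one]
  refine algebraMap_le_of_le_spectrum fun x hx => ?_
  obtain ⟨i, rfl⟩ := hM.spectrum_real_eq_range_eigenvalues ▸ hx
  exact ciInf_le (Set.finite_range hM.eigenvalues).bddBelow i

theorem correlationMatrix_apply (i j : Fin d) :
    correlationMatrix P i j =
      cov[fun x => x i, fun x => x j; P] / (√Var[fun x => x i; P] * √Var[fun x => x j; P]) := by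
  simp only [correlationMatrix, Matrix.of_apply, standardized, div_mul_div_comm, integral_div,
    covariance]

theorem correlationMatrix_apply_self {i : Fin d} (hvar : 0 < Var[fun x : Fin d → ℝ => x i; P]) :
    correlationMatrix P i i = 1 := by
  rw [correlationMatrix_apply, covariance_self (measurable_pi_apply i).aemeasurable,
    Real.mul_self_sqrt hvar.le, div_self hvar.ne']

theorem posSemidef_covarianceMatrix_sub_smul_diagonal
    (hvar : ∀ i, 0 < Var[fun x : Fin d → ℝ => x i; P]) {c : ℝ}
    (hc : (correlationMatrix P - c • (1 : Matrix (Fin d) (Fin d) ℝ)).PosSemidef) :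
    (covarianceMatrix (fun i (x : Fin d → ℝ) => x i) P -
      c • Matrix.diagonal (covarianceMatrix (fun i (x : Fin d → ℝ) => x i) P).diag).PosSemidef := by
  set σ : Fin d → ℝ := fun i => √Var[fun x : Fin d → ℝ => x i; P]
  have hσ : ∀ i, σ i ≠ 0 := fun i => (Real.sqrt_pos.2 (hvar i)).ne'
  have h_entry : ∀ i j, covarianceMatrix (fun i (x : Fin d → ℝ) => x i) P i j =
      σ i * correlationMatrix P i j * σ j := fun i j => by
    rw [correlationMatrix_apply]
    change cov[fun x => x i, fun x => x j; P] = σ i * (_ / (σ i * σ j)) * σ j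
    field_simp [hσ i, hσ j]
  have h_scale : covarianceMatrix (fun i (x : Fin d → ℝ) => x i) P -
      c • Matrix.diagonal (covarianceMatrix (fun i (x : Fin d → ℝ) => x i) P).diag =
      Matrix.diagonal σ * (correlationMatrix P - c • 1) * (Matrix.diagonal σ)ᴴ := by
    ext i j
    simp only [Matrix.diagonal_conjTranspose, star_trivial, Matrix.mul_diagonal,
      Matrix.diagonal_mul, Matrix.sub_apply, Matrix.smul_apply, smul_eq_mul]
    obtain rfl | hij := eq_or_ne i j
    · rw [Matrix.diagonal_apply_eq, Matrix.diag_apply, h_entry,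
        correlationMatrix_apply_self (hvar i), Matrix.one_apply_eq]
      ring
    · rw [Matrix.diagonal_apply_ne _ hij, Matrix.one_apply_ne hij, h_entry]
      ring
  exact h_scale ▸ hc.mul_mul_conjTranspose_same _

theorem lambdaMin_correlationMatrix_le_one {i : Fin d}
    (hvar : 0 < Var[fun x : Fin d → ℝ => x i; P]) :
    lambdaMin (correlationMatrix_isHermitian P) ≤ 1 := by
  have h := (posSemidef_sub_lambdaMin (correlationMatrix_isHermitian P)).diag_nonneg (i := i)
  simpa [correlationMatrix_apply_self hvar] using h

end CorrelationMatrix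

theorem secondMoment_eq_ofReal_integral_sq {Ω : Type*} [MeasurableSpace Ω] {μ : Measure Ω}
    {h : Ω → ℝ} (hh : MemLp h 2 μ) : secondMoment μ h = ENNReal.ofReal (∫ x, h x ^ 2 ∂μ) :=
  (ofReal_integral_eq_lintegral_ofReal hh.integrable_sq (.of_forall fun _ => sq_nonneg _)).symm

theorem secondMoment_lt_top_iff_memLp {Ω : Type*} [MeasurableSpace Ω] {μ : Measure Ω}
    {h : Ω → ℝ} (hm : AEStronglyMeasurable h μ) : secondMoment μ h < ⊤ ↔ MemLp h 2 μ := by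
  rw [memLp_two_iff_integrable_sq hm, secondMoment,
    ← hasFiniteIntegral_iff_ofReal (.of_forall fun x => sq_nonneg (h x))]
  exact ⟨fun hi => ⟨hm.pow 2, hi⟩, fun hi => hi.2⟩

section AdditiveClass

variable {d : ℕ} {P Q : Measure (Fin d → ℝ)} {F G : (Fin d → ℝ) → ℝ}

theorem mem_additiveClass_iff :
    F ∈ additiveClass P ↔ ∃ f : Fin d → ℝ → ℝ,
      (∀ i, MemLp (f i) 2 (P.map fun x => x i)) ∧ F = fun x => ∑ i, f i (x i) := by
  have h_memLp : ∀ (f : ℝ → ℝ) (i : Fin d), MemLp f 2 (P.map fun x => x i) ↔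
      AEMeasurable f (P.map fun x => x i) ∧ secondMoment P (fun x => f (x i)) < ⊤ := fun f i => by
    have h_eval : AEMeasurable (fun x : Fin d → ℝ => x i) P := (measurable_pi_apply i).aemeasurable
    refine ⟨fun hf => ⟨hf.aemeasurable, ?_⟩, fun ⟨hf, hf2⟩ => ?_⟩
    · exact (secondMoment_lt_top_iff_memLp (hf.1.comp_aemeasurable h_eval)).2
        (hf.comp_of_map h_eval)
    · have hfs := hf.aestronglyMeasurable
      exact (memLp_map_measure_iff hfs h_eval).2
        ((secondMoment_lt_top_iff_memLp (hfs.comp_aemeasurable h_eval)).1 hf2)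
  simp only [additiveClass, Set.mem_ofPred_eq, h_memLp, forall_and, and_assoc]

theorem sub_mem_additiveClass (hF : F ∈ additiveClass P) (hG : G ∈ additiveClass P) :
    (fun x => F x - G x) ∈ additiveClass P := by
  obtain ⟨f, hf, rfl⟩ := mem_additiveClass_iff.1 hF
  obtain ⟨g, hg, rfl⟩ := mem_additiveClass_iff.1 hG
  refine mem_additiveClass_iff.2 ⟨fun i => f i - g i, fun i => (hf i).sub (hg i), ?_⟩
  simp only [Pi.sub_apply, Finset.sum_sub_distrib]

theorem ofReal_lambdaMin_mul_secondMoment_le (hd : 0 < d) [IsProbabilityMeasure P]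
    [IsProbabilityMeasure Q] (hmarg : ∀ i : Fin d, P.map (fun x => x i) = Q.map (fun x => x i))
    (hgauss : ∀ i j : Fin d, IsGaussian (P.map fun x => (x i, x j)))
    (hvar : ∀ i, 0 < Var[fun x : Fin d → ℝ => x i; P]) (hF : F ∈ additiveClass P) :
    ENNReal.ofReal (lambdaMin (correlationMatrix_isHermitian P)) * secondMoment Q F ≤
      d * secondMoment P F := by
  obtain ⟨f, hf, rfl⟩ := mem_additiveClass_iff.1 hF
  set c := lambdaMin (correlationMatrix_isHermitian P)
  obtain hc | hc := le_total c 0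
  · simp [ENNReal.ofReal_of_nonpos hc]
  have hP : ∀ i, MeasurePreserving (fun x : Fin d → ℝ => x i) P (P.map fun x => x i) := fun i =>
    (measurable_pi_apply i).measurePreserving P
  have hQ : ∀ i, MeasurePreserving (fun x : Fin d → ℝ => x i) Q (P.map fun x => x i) := fun i =>
    ⟨measurable_pi_apply i, (hmarg i).symm⟩
  have hcd : c ≤ Fintype.card (Fin d) := by
    rw [Fintype.card_fin]
    exact (lambdaMin_correlationMatrix_le_one (hvar ⟨0, hd⟩)).trans (by exact_mod_cast hd)
  have h_real := mul_integral_sq_sum_comp_le_card_mul_integral_sq_sum_comp hP hQ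
    (fun i j => ⟨hgauss i j⟩) (posSemidef_covarianceMatrix_sub_smul_diagonal hvar
      (posSemidef_sub_lambdaMin _)) hc hcd hf
  rw [Fintype.card_fin] at h_real
  rw [secondMoment_eq_ofReal_integral_sq (memLp_sum_comp hP hf),
    secondMoment_eq_ofReal_integral_sq (memLp_sum_comp hQ hf), ← ENNReal.ofReal_natCast,
    ← ENNReal.ofReal_mul hc, ← ENNReal.ofReal_mul d.cast_nonneg]
  exact ENNReal.ofReal_le_ofReal h_real

end AdditiveClass

theorem mainTheorem2 (d : ℕ) (hd : 0 < d)
    (P Q : Measure (Fin d → ℝ)) [IsProbabilityMeasure P] [IsProbabilityMeasure Q]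
    (hmarg : ∀ i : Fin d, P.map (fun x => x i) = Q.map (fun x => x i))
    (hgauss : ∀ i j : Fin d, IsGaussian (P.map (fun x => (x i, x j))))
    (hvar : ∀ i : Fin d, 0 < variance (fun x : Fin d → ℝ => x i) P) :
    restrictedErrorRatio P Q (additiveClass P) ≤
      (d : ENNReal) / ENNReal.ofReal (lambdaMin (correlationMatrix_isHermitian P)) := by
  refine iSup₂_le fun f hf => iSup₂_le fun g hg => ?_
  rw [ENNReal.le_div_iff_mul_le (.inr (Nat.cast_ne_zero.2 hd.ne'))
    (.inr (ENNReal.natCast_ne_top d)), mul_comm, ← mul_div_assoc]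
  exact ENNReal.div_le_of_le_mul <| ofReal_lambdaMin_mul_secondMoment_le hd hmarg hgauss hvar <|
    sub_mem_additiveClass hf hg
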